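/- \textbf{Setting.} There are $n$ learners, numbered $1,\dots,n$, on an undirected graph $\mathcal G=([n],E)$, and $T$ rounds. In round $t$ every learner $i$ plays a point $\mathbf x_i(t)$ of a convex set $\mathcal K\subseteq\mathbb R^d$, then observes its own loss function $f_{t,i}$, and then communicates once with its immediate neighbours in $\mathcal G$. A \emph{D-OCO algorithm} prescribes each decision of learner $i$ as a function of the local state of $i$, and each new local state as a function of the old one, of $f_{t,i}$ and of the messages of the neighbours of $i$ in that round; the states and messages are arbitrary (in particular, a gossip step $\sum_j P_{ij}\mathbf v_j$ is allowed). The algorithm may depend on $n,d,T,\alpha,R,\mathcal K$, on the graph $\mathcal G$ and on the communication matrix $P$, and may use a random seed. With $f_t=\sum_{j=1}^n f_{t,j}$, the regret of learner $i$ is \[R_{T,i}=\sum_{t=1}^T f_t(\mathbf x_i(t))-\min_{\mathbf x\in\mathcal K}\sum_{t=1}^T f_t(\mathbf x).\] A matrix $P\in\mathbb R^{n\times n}$ is \emph{admissible} for $\mathcal G$ if it is symmetric, doubly stochastic and positive semidefinite, $P_{ij}>0$ only if $(i,j)\in E$ or $i=j$, and its second largest singular value satisfies $\sigma_2(P)<1$.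 \textbf{Theorem.} Let $\alpha,R>0$, $d\ge 1$, $\mathcal K=[0,R/\sqrt d]^d$, $n=2(m+1)$ for a positive integer $m$, and $T\ge 16n+1$. For any D-OCO algorithm there exist losses $f_{t,i}$ that are $\alpha$-strongly convex over $\mathcal K$, i.e. $f_{t,i}(\mathbf y)\ge f_{t,i}(\mathbf x)+\langle\nabla f_{t,i}(\mathbf x),\mathbf y-\mathbf x\rangle+\frac{\alpha}{2}\|\mathbf y-\mathbf x\|_2^2$ for all $\mathbf x,\mathbf y\in\mathcal K$, and $G$-Lipschitz over $\mathcal K$ with $G=\alpha R$, and a graph $\mathcal G$, namely the cycle on $[n]$, and a matrix $P$ admissible for it, such that \[R_{T,1}\ \ge\ \frac{16^{-5}\,\alpha\pi\,\bigl(\log_{16}(30(T-1)/n)-2\bigr)(n-2)R^2}{4\sqrt{1-\sigma_2(P)}}.\] If the algorithm is randomized, the losses, the graph and $P$ do not depend on the random seed, and the bound holds for the expectation of $R_{T,1}$. Moreover, with $\rho=1-\sigma_2(P)$, this is a bound of order $\Omega(n\rho^{-1/2}\log T)$ in the following sense: for every $\delta>0$ there is a constant $c>0$ depending only on $\delta$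 such that for the same losses, graph and $P$ the (expected) regret $R_{T,1}$ is also at least $c\,\alpha R^2\, n\rho^{-1/2}\log T$ whenever $T\ge n^{1+\delta}$. -/

import Mathlib

open MeasureTheory

namespace DOCO

universe u v

/-! ### Losses and the decision set -/

/-- The decision set `[0, R / √d]^d` in Euclidean `ℝ^d`. -/
def box (d : ℕ) (R : ℝ) : Set (EuclideanSpace ℝ (Fin d)) :=
  {x | ∀ j, 0 ≤ x j ∧ x j ≤ R / √(d : ℝ)}

/-- `f` is differentiable on `K` and
`f y ≥ f x + ⟨∇ f x, y - x⟩ + (α / 2) ‖y - x‖²` for all `x, y ∈ K`. -/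
def StronglyConvexLoss {d : ℕ} (K : Set (EuclideanSpace ℝ (Fin d))) (α : ℝ)
    (f : EuclideanSpace ℝ (Fin d) → ℝ) : Prop :=
  (∀ x ∈ K, DifferentiableAt ℝ f x) ∧
    ∀ x ∈ K, ∀ y ∈ K,
      f x + inner ℝ (gradient f x) (y - x) + α / 2 * ‖y - x‖ ^ 2 ≤ f y

/-- `f` is `L`-Lipschitz over `K` for the Euclidean norm. -/
def LipschitzLoss {d : ℕ} (K : Set (EuclideanSpace ℝ (Fin d))) (L : ℝ)
    (f : EuclideanSpace ℝ (Fin d) → ℝ) : Prop :=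
  ∀ x ∈ K, ∀ y ∈ K, |f x - f y| ≤ L * ‖x - y‖

/-- The local losses `f t i` of all learners `i` in all rounds `t < T` are `α`-strongly convex and
`L`-Lipschitz over `K`. Rounds are numbered `0, …, T - 1`. -/
def AdmissibleLosses {n d : ℕ} (K : Set (EuclideanSpace ℝ (Fin d))) (α L : ℝ) (T : ℕ)
    (f : ℕ → Fin n → EuclideanSpace ℝ (Fin d) → ℝ) : Prop :=
  ∀ t < T, ∀ i, StronglyConvexLoss K α (f t i) ∧ LipschitzLoss K L (f t i)

/-! ### Communication matrices -/

/-- The second largest singular value, counted with multiplicity (Mathlib numbers the singular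
values in decreasing order starting from `0`). -/
noncomputable def sigma2 {n : ℕ} (P : Matrix (Fin n) (Fin n) ℝ) : ℝ :=
  (Matrix.toEuclideanLin P).singularValues 1

/-- `P` is supported on `G` and its diagonal, symmetric, doubly stochastic, positive semidefinite,
and its second largest singular value is smaller than `1`. -/
structure IsCommunicationMatrix {n : ℕ} (G : SimpleGraph (Fin n))
    (P : Matrix (Fin n) (Fin n) ℝ) : Prop where
  supported : ∀ i j, 0 < P i j → G.Adj i j ∨ i = j
  symm : P.IsSymm
  doublyStochastic : P ∈ doublyStochastic ℝ (Fin n)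
  posSemidef : P.PosSemidef
  sigma2_lt_one : sigma2 P < 1

/-! ### Decentralized online algorithms -/

/-- A deterministic decentralized online algorithm for `n` learners on the graph `G` with decision
set `K`. Every learner holds a local state. In round `t`, learner `i` plays `decide t i s` where `s`
is its state, then observes its own loss function and updates its state by `observe`, then sends
one message `send t i s` to its neighbours, and finally updates its state by `receive`, using the
messages of its own neighbours. States and messages are arbitrary. In particular a gossip step with
a matrix `P` supported on `G` is the case where messages are vectors `v j` and `receive` uses
`P i i • v i + ∑ j, P i j • v j`, with `j` ranging over the neighbours of `i`. -/
structure Algorithm {n d : ℕ} (G : SimpleGraph (Fin n))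
    (K : Set (EuclideanSpace ℝ (Fin d))) where
  State : Type u
  Msg : Type v
  init : Fin n → State
  decide : ℕ → Fin n → State → EuclideanSpace ℝ (Fin d)
  decide_mem : ∀ t i s, decide t i s ∈ K
  observe : ℕ → Fin n → State → (EuclideanSpace ℝ (Fin d) → ℝ) → State
  send : ℕ → Fin n → State → Msg
  receive : ℕ → (i : Fin n) → State → (G.neighborSet i → Msg) → State

namespace Algorithm

variable {n d : ℕ} {G : SimpleGraph (Fin n)} {K : Set (EuclideanSpace ℝ (Fin d))}

/-- State of each learner at the beginning of round `t`. -/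
def stateAt (A : Algorithm.{u, v} G K) (f : ℕ → Fin n → EuclideanSpace ℝ (Fin d) → ℝ) :
    ℕ → Fin n → A.State
  | 0, i => A.init i
  | t + 1, i =>
    A.receive t i (A.observe t i (A.stateAt f t i) (f t i))
      (fun j => A.send t j (A.observe t j (A.stateAt f t j) (f t j)))

/-- Decision of learner `i` in round `t` against the losses `f`. -/
def decision (A : Algorithm.{u, v} G K) (f : ℕ → Fin n → EuclideanSpace ℝ (Fin d) → ℝ)
    (t : ℕ) (i : Fin n) : EuclideanSpace ℝ (Fin d) :=
  A.decide t i (A.stateAt f t i)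

end Algorithm

/-- The global loss `∑ j, f t j` of round `t`. -/
def globalLoss {n d : ℕ} (f : ℕ → Fin n → EuclideanSpace ℝ (Fin d) → ℝ) (t : ℕ)
    (x : EuclideanSpace ℝ (Fin d)) : ℝ :=
  ∑ j, f t j x

/-- Regret over `T` rounds of learner `i` with respect to the global losses. The infimum is a
minimum as soon as `K` is compact and nonempty and the losses are continuous on `K`. -/
noncomputable def regret {n d : ℕ} {G : SimpleGraph (Fin n)}
    {K : Set (EuclideanSpace ℝ (Fin d))} (A : Algorithm.{u, v} G K)
    (f : ℕ → Fin n → EuclideanSpace ℝ (Fin d) → ℝ) (T : ℕ) (i : Fin n) : ℝ :=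
  ∑ t ∈ Finset.range T, globalLoss f t (A.decision f t i) -
    sInf ((fun x => ∑ t ∈ Finset.range T, globalLoss f t x) '' K)

end DOCO

/-! The adversary hides one random bit per block of rounds. Time is cut into `B` blocks of `D = n /
4` rounds. In block `k` the far learners, at distance at least `D` from learner `0` and at least
half of all, have a quadratic loss centred at the bit `w k` times the corner of the box; the others
have one centred at the origin. News needs `D` rounds to travel, so learner `0` plays all of block
`k` knowing earlier bits only (`prediction_congr`). For each offset inside a block, its decisions
thus form an online predictor of a binary sequence under the square loss.

The bits come from a Pólya urn (uniform bias, then independent tosses). Not knowing the bias costs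
`1 / (6 (k + 2))` at step `k` on average, and the harmonic sum gives `log_le_urn_regret`. Multiplied
by the `D` offsets and the scale of the losses, this is regret of order `α R² n² log (T / n)`. Urn
average and expectation over the seed commute, so one sequence `w` is bad for the randomized
algorithm.

The lazy walk on the cycle has spectral gap at least `1 / (8 n²)` (`sigma2_lazyWalk_le`), so one
factor `n` dominates `1 / (4 √(1 - σ₂))`. -/

namespace DOCO

/-! ### Spectral gap of the lazy walk on the cycle -/

/-- A contraction factor on the vectors with zero coordinate sum bounds the second singular
value. -/
lemma sigma2_le_of_norm_le {n : ℕ} (P : Matrix (Fin n) (Fin n) ℝ) (s : ℝ) (hs : 0 ≤ s)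
    (h : ∀ x : EuclideanSpace ℝ (Fin n), ∑ i, x i = 0 →
      ‖Matrix.toEuclideanLin P x‖ ≤ s * ‖x‖) : sigma2 P ≤ s := by
  unfold sigma2
  set T := Matrix.toEuclideanLin P with hT
  have hfr : Module.finrank ℝ (EuclideanSpace ℝ (Fin n)) = n := by simp
  -- For `n ≤ 1` the singular value of index `1` is `0` by convention.
  rcases le_or_gt n 1 with hn | hn
  · rw [T.singularValues_of_finrank_le (by rw [hfr]; exact hn)]; exact hs
  have hsym := T.isSymmetric_adjoint_comp_self
  set lam := hsym.eigenvalues hfr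
  set v := hsym.eigenvectorBasis hfr
  let i0 : Fin n := ⟨0, by omega⟩
  let i1 : Fin n := ⟨1, hn⟩
  have hsq : T.singularValues 1 ^ 2 = lam i1 := T.sq_singularValues_of_lt hfr hn
  have hanti : lam i1 ≤ lam i0 := hsym.eigenvalues_antitone hfr (by simp [i0, i1])
  have key : ∀ a b : ℝ, ‖T (a • v i0 + b • v i1)‖ ^ 2 = lam i0 * a ^ 2 + lam i1 * b ^ 2 ∧
      ‖a • v i0 + b • v i1‖ ^ 2 = a ^ 2 + b ^ 2 := by
    intro a b
    have h01 : inner ℝ (v i0) (v i1) = 0 := v.orthonormal.2 (by simp [i0, i1])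
    have h10 : inner ℝ (v i1) (v i0) = 0 := v.orthonormal.2 (by simp [i0, i1])
    have h00 : inner ℝ (v i0) (v i0) = (1 : ℝ) := by simp [v.orthonormal.1]
    have h11 : inner ℝ (v i1) (v i1) = (1 : ℝ) := by simp [v.orthonormal.1]
    have e0 : (LinearMap.adjoint T ∘ₗ T) (v i0) = lam i0 • v i0 :=
      hsym.apply_eigenvectorBasis hfr i0
    have e1 : (LinearMap.adjoint T ∘ₗ T) (v i1) = lam i1 • v i1 :=
      hsym.apply_eigenvectorBasis hfr i1
    constructor
    · rw [← real_inner_self_eq_norm_sq, ← LinearMap.adjoint_inner_left, ← LinearMap.comp_apply,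
        map_add, map_smul, map_smul, e0, e1]
      simp only [inner_add_left, inner_add_right, real_inner_smul_left, real_inner_smul_right,
        h01, h10, h00, h11]
      ring
    · rw [← real_inner_self_eq_norm_sq]
      simp only [inner_add_left, inner_add_right, real_inner_smul_left, real_inner_smul_right,
        h01, h10, h00, h11]
      ring
  -- Min-max argument: the plane of the top two right singular vectors meets the zero-sum
  -- hyperplane, and on this plane `T` stretches by at least the second singular value.
  obtain ⟨a, b, hab, hsum⟩ : ∃ a b : ℝ, 0 < a ^ 2 + b ^ 2 ∧
      ∑ i, (a • v i0 + b • v i1) i = 0 := by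
    have hS : ∀ a b : ℝ, ∑ i, (a • v i0 + b • v i1) i = a * ∑ i, v i0 i + b * ∑ i, v i1 i := by
      intro a b
      simp [Finset.sum_add_distrib, Finset.mul_sum]
    by_cases h1 : ∑ i, v i1 i = 0
    · exact ⟨0, 1, by norm_num, by rw [hS, h1]; ring⟩
    · refine ⟨∑ i, v i1 i, -∑ i, v i0 i, by positivity, by rw [hS]; ring⟩
  have h2 := h _ hsum
  obtain ⟨k1, k2⟩ := key a b
  have h3 : ‖T (a • v i0 + b • v i1)‖ ^ 2 ≤ s ^ 2 * (a ^ 2 + b ^ 2) := by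
    rw [← k2, ← mul_pow]
    exact pow_le_pow_left₀ (norm_nonneg _) h2 2
  rw [k1] at h3
  have h4 : lam i1 * (a ^ 2 + b ^ 2) ≤ s ^ 2 * (a ^ 2 + b ^ 2) := by
    nlinarith [mul_le_mul_of_nonneg_right hanti (sq_nonneg a)]
  have h5 := le_of_mul_le_mul_right h4 hab
  rw [← hsq] at h5
  exact le_of_sq_le_sq h5 hs

section Gossip

variable {n : ℕ} [NeZero n]

/-- The average of the identity and the cyclic shift. -/
noncomputable def halfShift (n : ℕ) [NeZero n] : Matrix (Fin n) (Fin n) ℝ :=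
  fun i j => (if j = i then 1 / 2 else 0) + (if j = i + 1 then 1 / 2 else 0)

/-- The lazy random walk on the cycle, with weights `1 / 4, 1 / 2, 1 / 4`. -/
noncomputable def lazyWalk (n : ℕ) [NeZero n] : Matrix (Fin n) (Fin n) ℝ :=
  halfShift n * (halfShift n).transpose

lemma halfShift_mulVec (x : Fin n → ℝ) (i : Fin n) :
    (halfShift n).mulVec x i = (x i + x (i + 1)) / 2 := by
  simp [halfShift, Matrix.mulVec, dotProduct, add_mul, Finset.sum_add_distrib]
  ring

lemma halfShift_transpose_mulVec (x : Fin n → ℝ) (i : Fin n) :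
    (halfShift n).transpose.mulVec x (i + 1) = (x (i + 1) + x i) / 2 := by
  simp [halfShift, Matrix.mulVec, dotProduct, add_mul, Finset.sum_add_distrib]
  ring

lemma halfShift_mem_doublyStochastic : halfShift n ∈ doublyStochastic ℝ (Fin n) := by
  rw [mem_doublyStochastic_iff_sum]
  refine ⟨fun i j => ?_, fun i => ?_, fun j => ?_⟩
  · unfold halfShift; positivity
  · simp [halfShift, Finset.sum_add_distrib]; norm_num
  · have : ∀ i : Fin n, (j = i + 1) ↔ (i = j - 1) := fun i => by
      rw [eq_comm, eq_sub_iff_add_eq]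
    simp [halfShift, Finset.sum_add_distrib, this]; norm_num

/-- Reindexing of a sum by the cyclic shift. -/
lemma sum_add_one (g : Fin n → ℝ) : ∑ i, g (i + 1) = ∑ i, g i :=
  Equiv.sum_comp (Equiv.addRight (1 : Fin n)) g

/-- Poincaré inequality on the cycle. -/
lemma sum_sq_le_of_sum_eq_zero (x : Fin n → ℝ) (hx : ∑ i, x i = 0) :
    ∑ i, x i ^ 2 ≤ (n : ℝ) ^ 2 * ∑ i, (x (i + 1) - x i) ^ 2 := by
  have hn : (0 : ℝ) < n := by exact_mod_cast Nat.pos_of_ne_zero (NeZero.ne n)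
  -- `Y k` is `x` rotated by `k`. Consecutive rotations are all `e` apart and the `n` rotations sum
  -- to `0`, so `Y 0` is the average of the `Y 0 - Y k`, each of norm at most `n * e`.
  let Y : ℕ → EuclideanSpace ℝ (Fin n) := fun k => WithLp.toLp 2 fun i => x (i + (Fin.ofNat n k))
  set e := ‖Y 1 - Y 0‖ with he
  have hstep : ∀ k, ‖Y (k + 1) - Y k‖ = e := by
    intro k
    rw [he, EuclideanSpace.norm_eq, EuclideanSpace.norm_eq]
    congr 1
    have hk : Fin.ofNat n (k + 1) = Fin.ofNat n k + 1 := by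
      ext; simp [Fin.ofNat, Fin.val_add]
    have h1 : Fin.ofNat n 1 = (1 : Fin n) := by ext; simp [Fin.ofNat]
    have h0 : Fin.ofNat n 0 = (0 : Fin n) := by ext; simp [Fin.ofNat]
    have := Equiv.sum_comp (Equiv.addRight (Fin.ofNat n k))
      (fun i : Fin n => ‖x (i + 1) - x i‖ ^ 2)
    simp only [Y, PiLp.sub_apply, hk, h1, h0, add_zero]
    rw [← this]
    simp [Equiv.coe_addRight, add_assoc]
  have hdist : ∀ k, ‖Y k - Y 0‖ ≤ k * e := by
    intro k
    induction k with
    | zero => simp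
    | succ k ih =>
      calc ‖Y (k + 1) - Y 0‖ = ‖(Y (k + 1) - Y k) + (Y k - Y 0)‖ := by congr 1; abel
        _ ≤ e + k * e := (norm_add_le _ _).trans (add_le_add (hstep k).le ih)
        _ = _ := by push_cast; ring
  have hsum : ∑ k : Fin n, Y k = 0 := by
    ext i
    have := Equiv.sum_comp (Equiv.addLeft i) x
    simp only [WithLp.ofLp_sum, Finset.sum_apply, Y, Fin.ofNat_val_eq_self]
    simpa [hx] using this
  have hnY : (n : ℝ) • Y 0 = ∑ k : Fin n, (Y 0 - Y k) := by
    rw [Finset.sum_sub_distrib, hsum]; simp [Nat.cast_smul_eq_nsmul]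
  have hnorm : (n : ℝ) * ‖Y 0‖ ≤ n * (n * e) := by
    calc (n : ℝ) * ‖Y 0‖ = ‖(n : ℝ) • Y 0‖ := by rw [norm_smul]; simp
      _ ≤ ∑ k : Fin n, ‖Y 0 - Y k‖ := by rw [hnY]; exact norm_sum_le _ _
      _ ≤ ∑ k : Fin n, (n : ℝ) * e := by
        refine Finset.sum_le_sum fun k _ => ?_
        rw [norm_sub_rev]
        refine (hdist k).trans (mul_le_mul_of_nonneg_right ?_ (norm_nonneg _))
        exact_mod_cast k.2.le
      _ = _ := by simp
  have h6 : ‖Y 0‖ ^ 2 ≤ (n * e) ^ 2 :=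
    pow_le_pow_left₀ (norm_nonneg _) (le_of_mul_le_mul_left hnorm hn) 2
  have h1 : Fin.ofNat n 1 = (1 : Fin n) := by ext; simp [Fin.ofNat]
  have h0 : Fin.ofNat n 0 = (0 : Fin n) := by ext; simp [Fin.ofNat]
  rw [mul_pow, he, EuclideanSpace.norm_sq_eq, EuclideanSpace.norm_sq_eq] at h6
  simpa only [Y, PiLp.sub_apply, h1, h0, Real.norm_eq_abs, sq_abs, add_zero] using h6

lemma sum_sq_halfShift_le (x : Fin n → ℝ) :
    ∑ i, (halfShift n).mulVec x i ^ 2 ≤ ∑ i, x i ^ 2 := by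
  have h := sum_add_one (fun i => x i ^ 2)
  calc ∑ i, (halfShift n).mulVec x i ^ 2 ≤ ∑ i, (x i ^ 2 + x (i + 1) ^ 2) / 2 := by
        refine Finset.sum_le_sum fun i _ => ?_
        rw [halfShift_mulVec]; nlinarith [sq_nonneg (x i - x (i + 1))]
    _ = _ := by rw [← Finset.sum_div, Finset.sum_add_distrib, h]; ring

/-- By the parallelogram law, averaging neighbours loses exactly a quarter of the Dirichlet energy,
which the Poincaré inequality bounds below. -/
lemma sum_sq_halfShift_transpose (x : Fin n → ℝ) :
    ∑ i, (halfShift n).transpose.mulVec x i ^ 2 =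
      ∑ i, x i ^ 2 - (∑ i, (x (i + 1) - x i) ^ 2) / 4 := by
  have h := sum_add_one (fun i => x i ^ 2)
  rw [← sum_add_one]
  have : ∀ i, (halfShift n).transpose.mulVec x (i + 1) ^ 2 =
      x i ^ 2 / 2 + x (i + 1) ^ 2 / 2 - (x (i + 1) - x i) ^ 2 / 4 := by
    intro i; rw [halfShift_transpose_mulVec]; ring
  simp only [this, Finset.sum_sub_distrib, Finset.sum_add_distrib, ← Finset.sum_div, h]
  ring

/-- The spectral gap of the lazy random walk on the cycle is at least of order `1 / n ^ 2`. -/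
lemma sigma2_lazyWalk_le : sigma2 (lazyWalk n) ≤ 1 - 1 / (8 * (n : ℝ) ^ 2) := by
  have hn : (1 : ℝ) ≤ n := by exact_mod_cast Nat.pos_of_ne_zero (NeZero.ne n)
  have hq : 1 / (8 * (n : ℝ) ^ 2) ≤ 1 / 8 := by
    apply one_div_le_one_div_of_le <;> nlinarith
  refine sigma2_le_of_norm_le _ _ (by linarith) fun x hx => ?_
  refine le_of_sq_le_sq ?_ (mul_nonneg (by linarith) (norm_nonneg _))
  have h1 : ‖Matrix.toEuclideanLin (lazyWalk n) x‖ ^ 2 =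
      ∑ i, (halfShift n).mulVec ((halfShift n).transpose.mulVec x) i ^ 2 := by
    rw [EuclideanSpace.norm_sq_eq]
    simp [Matrix.toLpLin_apply, lazyWalk, sq_abs]
  have h2 := sum_sq_halfShift_le ((halfShift n).transpose.mulVec x)
  rw [sum_sq_halfShift_transpose] at h2
  have h3 := sum_sq_le_of_sum_eq_zero x hx
  have h4 : ‖x‖ ^ 2 = ∑ i, x i ^ 2 := by rw [EuclideanSpace.norm_sq_eq]; simp [sq_abs]
  rw [h1, mul_pow, h4]
  set A := ∑ i, x i ^ 2
  set E := ∑ i, (x (i + 1) - x i) ^ 2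
  have h5 : A / (n : ℝ) ^ 2 ≤ E := by
    rw [div_le_iff₀ (by positivity)]; linarith
  have hA : 0 ≤ A := Finset.sum_nonneg fun i _ => sq_nonneg _
  -- The linear term of this square is exactly the guaranteed loss `A / (4 n²)`; this fixes the
  -- constant `8`.
  have h7 : (1 - 1 / (8 * (n : ℝ) ^ 2)) ^ 2 * A =
      A - A / n ^ 2 / 4 + (1 / (8 * (n : ℝ) ^ 2)) ^ 2 * A := by field_simp; ring
  rw [h7]
  have : 0 ≤ (1 / (8 * (n : ℝ) ^ 2)) ^ 2 * A := by positivity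
  linarith

lemma lazyWalk_pos {i j : Fin n} (h : 0 < lazyWalk n i j) : i = j ∨ j = i + 1 ∨ i = j + 1 := by
  by_contra! hc
  obtain ⟨h1, h2, h3⟩ := hc
  have : lazyWalk n i j = 0 := by
    rw [lazyWalk, Matrix.mul_apply]
    refine Finset.sum_eq_zero fun k _ => ?_
    simp only [halfShift, Matrix.transpose_apply]
    by_cases hk : k = i
    · subst hk; simp [h1, h3]
    · by_cases hk' : k = i + 1
      · subst hk'; simp [h1, h2.symm]
      · simp [hk, hk']
  exact h.ne' this

lemma isCommunicationMatrix_lazyWalk {n : ℕ} [NeZero n] (hn : 2 ≤ n) :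
    IsCommunicationMatrix (SimpleGraph.cycleGraph n) (lazyWalk n) where
  supported i j hij := by
    obtain ⟨k, rfl⟩ : ∃ k, n = k + 2 := ⟨n - 2, by omega⟩
    rcases lazyWalk_pos hij with h | h | h
    · exact Or.inr h
    · left; rw [SimpleGraph.cycleGraph_adj]; right; rw [h]; simp
    · left; rw [SimpleGraph.cycleGraph_adj]; left; rw [h]; simp
  symm := by
    rw [lazyWalk, Matrix.IsSymm, Matrix.transpose_mul, Matrix.transpose_transpose]
  doublyStochastic := mul_mem halfShift_mem_doublyStochastic
    (transpose_mem_doublyStochastic_iff.2 halfShift_mem_doublyStochastic)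
  posSemidef := by
    have := Matrix.posSemidef_self_mul_conjTranspose (halfShift n)
    rwa [Matrix.conjTranspose_eq_transpose_of_trivial] at this
  sigma2_lt_one := by
    have : (0 : ℝ) < n := by exact_mod_cast (by omega : 0 < n)
    have h : 0 < 1 / (8 * (n : ℝ) ^ 2) := by positivity
    linarith [sigma2_lazyWalk_le (n := n)]

lemma one_div_sqrt_one_sub_sigma2_lazyWalk_le : 1 / √(1 - sigma2 (lazyWalk n)) ≤ 4 * n := by
  have hn : (0 : ℝ) < n := by exact_mod_cast Nat.pos_of_ne_zero (NeZero.ne n)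
  have h : 1 / (4 * (n : ℝ)) ≤ √(1 - sigma2 (lazyWalk n)) := by
    apply Real.le_sqrt_of_sq_le
    have : (1 / (4 * (n : ℝ))) ^ 2 ≤ 1 / (8 * (n : ℝ) ^ 2) := by
      rw [div_pow, one_pow]
      apply one_div_le_one_div_of_le <;> nlinarith [sq_nonneg (n : ℝ), pow_pos hn 2]
    linarith [sigma2_lazyWalk_le (n := n)]
  calc 1 / √(1 - sigma2 (lazyWalk n)) ≤ 1 / (1 / (4 * (n : ℝ))) :=
        one_div_le_one_div_of_le (by positivity) h
    _ = _ := by simp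

end Gossip

/-! ### Predicting the outcomes of a Pólya urn -/

section Urn

/-- The indicator of an outcome, as a real number. -/
def bit (b : Bool) : ℝ := if b then 1 else 0

@[simp] lemma bit_true : bit true = 1 := rfl

@[simp] lemma bit_false : bit false = 0 := rfl

lemma bit_nonneg (b : Bool) : 0 ≤ bit b := by cases b <;> simp

lemma bit_le_one (b : Bool) : bit b ≤ 1 := by cases b <;> simp

lemma bit_sq (b : Bool) : bit b ^ 2 = bit b := by cases b <;> simp

/-- Number of successes among the first `k` outcomes. -/
def successes (k : ℕ) (w : ℕ → Bool) : ℝ := ∑ j ∈ Finset.range k, bit (w j)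

/-- Laplace's rule of succession. -/
noncomputable def laplace (k : ℕ) (w : ℕ → Bool) : ℝ := (successes k w + 1) / (k + 2)

/-- Expectation over the first `k` draws of a Pólya urn; all later outcomes are failures. -/
noncomputable def urn : ℕ → ((ℕ → Bool) → ℝ) → ℝ
  | 0, F => F fun _ => false
  | k + 1, F => urn k fun w =>
      laplace k w * F (Function.update w k true) +
        (1 - laplace k w) * F (Function.update w k false)

lemma successes_nonneg (k : ℕ) (w : ℕ → Bool) : 0 ≤ successes k w :=
  Finset.sum_nonneg fun _ _ => bit_nonneg _

lemma successes_le (k : ℕ) (w : ℕ → Bool) : successes k w ≤ k := by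
  calc successes k w ≤ ∑ _j ∈ Finset.range k, (1 : ℝ) := Finset.sum_le_sum fun _ _ => bit_le_one _
    _ = k := by simp

lemma laplace_nonneg (k : ℕ) (w : ℕ → Bool) : 0 ≤ laplace k w :=
  div_nonneg (by linarith [successes_nonneg k w]) (by positivity)

lemma laplace_le_one (k : ℕ) (w : ℕ → Bool) : laplace k w ≤ 1 := by
  rw [laplace, div_le_one (by positivity)]; linarith [successes_le k w]

lemma successes_congr {k : ℕ} {w w' : ℕ → Bool} (h : ∀ j < k, w j = w' j) :
    successes k w = successes k w' :=
  Finset.sum_congr rfl fun j hj => by rw [h j (Finset.mem_range.1 hj)]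

lemma update_eq_of_lt {k : ℕ} (w : ℕ → Bool) (b : Bool) : ∀ j < k, Function.update w k b j = w j :=
  fun _ hj => Function.update_of_ne hj.ne _ _

lemma successes_update (k : ℕ) (w : ℕ → Bool) (b : Bool) :
    successes (k + 1) (Function.update w k b) = successes k w + bit b := by
  rw [successes, Finset.sum_range_succ, Function.update_self]
  exact congrArg (· + bit b) (successes_congr (update_eq_of_lt w b))

lemma urn_mono (k : ℕ) {F G : (ℕ → Bool) → ℝ} (h : ∀ w, F w ≤ G w) : urn k F ≤ urn k G := by
  induction k generalizing F G with
  | zero => exact h _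
  | succ k ih =>
    refine ih fun w => add_le_add ?_ ?_
    · exact mul_le_mul_of_nonneg_left (h _) (laplace_nonneg k w)
    · exact mul_le_mul_of_nonneg_left (h _) (by linarith [laplace_le_one k w])

lemma urn_linear (k : ℕ) (F G : (ℕ → Bool) → ℝ) (a b : ℝ) :
    urn k (fun w => a * F w + b * G w) = a * urn k F + b * urn k G := by
  induction k generalizing F G with
  | zero => rfl
  | succ k ih =>
    simp only [urn]
    rw [← ih]
    congr 1; funext w; ring

@[simp] lemma urn_const (k : ℕ) (c : ℝ) : urn k (fun _ => c) = c := by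
  induction k with
  | zero => rfl
  | succ k ih =>
    simp only [urn]
    calc _ = urn k (fun _ => c) := by congr 1; funext w; ring
      _ = c := ih

lemma urn_add (k : ℕ) (F G : (ℕ → Bool) → ℝ) :
    urn k (fun w => F w + G w) = urn k F + urn k G := by
  simpa using urn_linear k F G 1 1

lemma urn_const_mul (k : ℕ) (F : (ℕ → Bool) → ℝ) (a : ℝ) :
    urn k (fun w => a * F w) = a * urn k F := by
  simpa using urn_linear k F F a 0

lemma urn_sum {ι : Type*} (s : Finset ι) (k : ℕ) (F : ι → (ℕ → Bool) → ℝ) :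
    urn k (fun w => ∑ r ∈ s, F r w) = ∑ r ∈ s, urn k (F r) := by
  classical
  induction s using Finset.induction_on with
  | empty => simp
  | insert a s ha ih => simp only [Finset.sum_insert ha]; rw [urn_add, ih]

/-- Some outcome sequence attains at least the urn expectation. -/
lemma exists_le_of_le_urn {k : ℕ} {F : (ℕ → Bool) → ℝ} {c : ℝ} (h : c ≤ urn k F) :
    ∃ w, c ≤ F w := by
  induction k generalizing F with
  | zero => exact ⟨_, h⟩
  | succ k ih =>
    obtain ⟨w, hw⟩ := ih h
    by_contra! hc
    have h1 := hc (Function.update w k true)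
    have h2 := hc (Function.update w k false)
    have := laplace_nonneg k w
    have := laplace_le_one k w
    rcases le_or_gt (laplace k w) (1 / 2) with h3 | h3 <;> nlinarith

/-- An urn expectation is a finite weighted sum, so it commutes with integration over the seed; this
allows outcomes chosen independently of the seed. -/
lemma urn_integral {Ω : Type*} [MeasurableSpace Ω] (μ : Measure Ω) (k : ℕ)
    (F : Ω → (ℕ → Bool) → ℝ) (hF : ∀ w, Integrable (fun ω => F ω w) μ) :
    Integrable (fun ω => urn k (F ω)) μ ∧
      urn k (fun w => ∫ ω, F ω w ∂μ) = ∫ ω, urn k (F ω) ∂μ := by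
  induction k generalizing F with
  | zero => exact ⟨hF _, rfl⟩
  | succ k ih =>
    simp only [urn]
    obtain ⟨h1, h2⟩ := ih (fun ω w => laplace k w * F ω (Function.update w k true) +
        (1 - laplace k w) * F ω (Function.update w k false))
      (fun w => ((hF _).const_mul _).add ((hF _).const_mul _))
    refine ⟨h1, ?_⟩
    rw [← h2]
    congr 1; funext w
    rw [integral_add ((hF _).const_mul _) ((hF _).const_mul _), integral_const_mul,
      integral_const_mul]

/-- The number of successes is uniform on `0, …, k`; only its first two moments are needed, and they
follow from the urn recursion. -/
lemma urn_successes (k : ℕ) : urn k (successes k) = k / 2 := by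
  induction k with
  | zero => simp [urn, successes]
  | succ k ih =>
    simp only [urn, successes_update, bit_true, bit_false]
    have : ∀ w, laplace k w * (successes k w + 1) + (1 - laplace k w) * (successes k w + 0) =
        (1 + 1 / ((k : ℝ) + 2)) * successes k w + (1 / ((k : ℝ) + 2)) * 1 := by
      intro w; rw [laplace]; field_simp; ring
    simp only [this]
    rw [urn_linear, ih, urn_const]
    push_cast; field_simp; ring

lemma urn_successes_sq (k : ℕ) : urn k (fun w => successes k w ^ 2) = k * (2 * k + 1) / 6 := by
  induction k with
  | zero => simp [urn, successes]
  | succ k ih =>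
    simp only [urn, successes_update, bit_true, bit_false]
    have : ∀ w, laplace k w * (successes k w + 1) ^ 2 +
          (1 - laplace k w) * (successes k w + 0) ^ 2 =
        1 * ((1 + 2 / ((k : ℝ) + 2)) * successes k w ^ 2 + (3 / ((k : ℝ) + 2)) * successes k w) +
          (1 / ((k : ℝ) + 2)) * 1 := by
      intro w; rw [laplace]; field_simp; ring
    simp only [this]
    rw [urn_linear, urn_linear, ih, urn_const, urn_successes]
    push_cast; field_simp; ring

/-- Here `1 / 6` is the mean variance of a toss with known uniform bias; the rest is the mean
posterior variance of the bias, the source of the logarithm. -/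
lemma urn_laplace_variance (k : ℕ) :
    urn k (fun w => laplace k w * (1 - laplace k w)) = 1 / 6 + 1 / (6 * ((k : ℝ) + 2)) := by
  have : ∀ w, laplace k w * (1 - laplace k w) =
      1 * ((-1 / ((k : ℝ) + 2) ^ 2) * successes k w ^ 2 +
        (k / ((k : ℝ) + 2) ^ 2) * successes k w) + ((k + 1) / ((k : ℝ) + 2) ^ 2) * 1 := by
    intro w; rw [laplace]; field_simp; ring
  simp only [this]
  rw [urn_linear, urn_linear, urn_successes, urn_successes_sq, urn_const]
  field_simp; ring

/-- Against the Pólya urn, no predictor that only uses past outcomes beats Laplace's rule. -/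
lemma le_urn_sum_sq (z : ℕ → (ℕ → Bool) → ℝ)
    (hz : ∀ k w w', (∀ j < k, w j = w' j) → z k w = z k w') (k : ℕ) :
    (k : ℝ) / 6 + (∑ j ∈ Finset.range k, 1 / ((j : ℝ) + 2)) / 6 ≤
      urn k (fun w => ∑ j ∈ Finset.range k, (z j w - bit (w j)) ^ 2) := by
  induction k with
  | zero => simp [urn]
  | succ k ih =>
    have hpast : ∀ w b, ∑ j ∈ Finset.range (k + 1),
          (z j (Function.update w k b) - bit (Function.update w k b j)) ^ 2 =
        ∑ j ∈ Finset.range k, (z j w - bit (w j)) ^ 2 + (z k w - bit b) ^ 2 := by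
      intro w b
      have hu := update_eq_of_lt (k := k) w b
      rw [Finset.sum_range_succ, Function.update_self, hz k _ w hu]
      congr 1
      refine Finset.sum_congr rfl fun j hj => ?_
      have hj := Finset.mem_range.1 hj
      rw [hu j hj, hz j _ w fun i hi => hu i (hi.trans hj)]
    simp only [urn, hpast]
    have h1 : urn k (fun w => ∑ j ∈ Finset.range k, (z j w - bit (w j)) ^ 2 +
        laplace k w * (1 - laplace k w)) ≤ urn k (fun w => laplace k w *
          (∑ j ∈ Finset.range k, (z j w - bit (w j)) ^ 2 + (z k w - bit true) ^ 2) +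
        (1 - laplace k w) *
          (∑ j ∈ Finset.range k, (z j w - bit (w j)) ^ 2 + (z k w - bit false) ^ 2)) := by
      refine urn_mono k fun w => ?_
      simp only [bit_true, bit_false]
      -- Bias-variance decomposition: with `p = laplace k w`, the conditional mean of the new error
      -- is `p (1 - p) + (z - p)²`.
      nlinarith [sq_nonneg (z k w - laplace k w)]
    refine le_trans ?_ h1
    rw [urn_add, urn_laplace_variance, Finset.sum_range_succ]
    have h2 : 1 / (6 * ((k : ℝ) + 2)) = 1 / ((k : ℝ) + 2) / 6 := by field_simp
    push_cast
    linarith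

lemma log_le_sum_inv (k : ℕ) :
    Real.log ((k : ℝ) + 2) ≤ 1 + ∑ j ∈ Finset.range k, 1 / ((j : ℝ) + 2) := by
  induction k with
  | zero => simpa using (Real.log_two_lt_d9.le.trans (by norm_num))
  | succ k ih =>
    rw [Finset.sum_range_succ]
    have h : Real.log (((k : ℝ) + 3) / (k + 2)) ≤ 1 / ((k : ℝ) + 2) := by
      refine (Real.log_le_sub_one_of_pos (by positivity)).trans (le_of_eq ?_)
      field_simp; ring
    rw [Real.log_div (by positivity) (by positivity)] at h
    push_cast
    rw [show (k : ℝ) + 1 + 2 = k + 3 by ring]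
    linarith

/-- Logarithmic lower bound for predicting binary outcomes with the square loss. -/
lemma log_le_urn_regret (z : ℕ → (ℕ → Bool) → ℝ)
    (hz : ∀ k w w', (∀ j < k, w j = w' j) → z k w = z k w') {B : ℕ} (hB : 1 ≤ B) :
    Real.log ((B : ℝ) + 2) / 6 ≤ urn B (fun w => ∑ k ∈ Finset.range B,
      ((z k w - bit (w k)) ^ 2 - (successes B w / B - bit (w k)) ^ 2)) := by
  have hB' : (0 : ℝ) < B := by exact_mod_cast hB
  have h1 : ∀ w, ∑ k ∈ Finset.range B,
      ((z k w - bit (w k)) ^ 2 - (successes B w / B - bit (w k)) ^ 2) =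
      1 * (∑ k ∈ Finset.range B, (z k w - bit (w k)) ^ 2) +
        1 * ((1 / (B : ℝ)) * successes B w ^ 2 + (-1) * successes B w) := by
    intro w
    rw [Finset.sum_sub_distrib]
    have : ∑ k ∈ Finset.range B, (successes B w / B - bit (w k)) ^ 2 =
        ∑ k ∈ Finset.range B, ((successes B w / B) ^ 2 +
          (1 - 2 * (successes B w / B)) * bit (w k)) :=
      Finset.sum_congr rfl fun k _ => by
        rw [sub_sq, bit_sq]; ring
    rw [this, Finset.sum_add_distrib, ← Finset.mul_sum]
    change _ - (_ + _ * successes B w) = _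
    simp only [Finset.sum_const, Finset.card_range, nsmul_eq_mul]
    field_simp; ring
  simp only [h1]
  rw [urn_linear, urn_linear, urn_successes, urn_successes_sq]
  have h2 := le_urn_sum_sq z hz B
  have h3 := log_le_sum_inv B
  -- The best constant costs `B / 2 - (2 B + 1) / 6 = B / 6 - 1 / 6` on average; the `- 1 / 6`
  -- supplies the `1` in `log_le_sum_inv`.
  have h4 : 1 / (B : ℝ) * (B * (2 * B + 1) / 6) = (2 * B + 1) / 6 := by field_simp
  rw [h4]
  linarith

end Urn

universe u v

/-! ### Speed of information on the graph -/

section Propagation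

variable {n d : ℕ} {G : SimpleGraph (Fin n)} {K : Set (EuclideanSpace ℝ (Fin d))}

/-- Losses that differ only from round `a` on, and up to round `b` only at learners of height `0`,
do not influence a learner of height `h i` before round `a + h i`. -/
lemma Algorithm.stateAt_congr (A : Algorithm.{u, v} G K) (h : Fin n → ℕ)
    (hG : ∀ i j, G.Adj i j → h i ≤ h j + 1)
    {f g : ℕ → Fin n → EuclideanSpace ℝ (Fin d) → ℝ} {a b : ℕ}
    (hfg : ∀ s j, s < b → (s < a ∨ 0 < h j) → f s j = g s j) (t : ℕ) (i : Fin n)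
    (hb : t ≤ b) (ht : t ≤ a + (h i - 1)) : A.stateAt f t i = A.stateAt g t i := by
  induction t generalizing i with
  | zero => rfl
  | succ t ih =>
    simp only [Algorithm.stateAt]
    -- If `t ≥ a`, the bound at `t + 1` forces `h i ≥ 2`, so the learner and its neighbours have
    -- positive height and see equal losses.
    rw [ih i (by omega) (by omega), hfg t i (by omega) (by omega)]
    congr 1
    funext j
    have := hG i j j.2
    rw [ih j (by omega) (by omega), hfg t j (by omega) (by omega)]

/-- Cyclic distance to vertex `0` changes by at most one along an edge, so `D` minus this distance
can serve as a height. -/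
lemma cycleGraph_adj_min_le {i j : Fin n} (h : (SimpleGraph.cycleGraph n).Adj i j) :
    min j.val (n - j.val) ≤ min i.val (n - i.val) + 1 := by
  rw [SimpleGraph.cycleGraph_adj'] at h
  have hi := i.2
  have hj := j.2
  rw [Fin.sub_def, Fin.sub_def] at h
  simp only at h
  have key : ∀ a b : ℕ, a < n → b < n → (n - a + b) % n = 1 → b = a + 1 ∨ b + n = a + 1 := by
    intro a b ha hb h
    rcases lt_or_ge (n - a + b) n with h1 | h1
    · rw [Nat.mod_eq_of_lt h1] at h; omega
    · rw [Nat.mod_eq_sub_mod h1] at h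
      rcases lt_or_ge (n - a + b - n) n with h2 | h2
      · rw [Nat.mod_eq_of_lt h2] at h; omega
      · have : n - a + b - n = n := by omega
        omega
  rcases h with h | h
  · have := key _ _ hj hi h; omega
  · have := key _ _ hi hj h; omega

end Propagation

/-! ### Quadratic losses centred on the diagonal of the box -/

section Quadratic

variable {d : ℕ} {R α : ℝ}

/-- The vertex of the box opposite to the origin. -/
noncomputable def corner (d : ℕ) (R : ℝ) : EuclideanSpace ℝ (Fin d) :=
  WithLp.toLp 2 fun _ => R / √(d : ℝ)

lemma norm_corner (hd : 1 ≤ d) (hR : 0 < R) : ‖corner d R‖ = R := by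
  have : (0 : ℝ) < d := by exact_mod_cast hd
  rw [EuclideanSpace.norm_eq, corner]
  simp only [Finset.sum_const, Finset.card_univ, Fintype.card_fin, nsmul_eq_mul, Real.norm_eq_abs,
    sq_abs, div_pow, Real.sq_sqrt this.le]
  rw [mul_div_cancel₀ _ this.ne', Real.sqrt_sq hR.le]

lemma smul_corner_mem_box (hR : 0 < R) {c : ℝ} (h0 : 0 ≤ c) (h1 : c ≤ 1) :
    c • corner d R ∈ box d R := by
  intro j
  have : 0 ≤ R / √(d : ℝ) := by positivity
  simp only [corner, PiLp.smul_apply, smul_eq_mul]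
  exact ⟨mul_nonneg h0 this, mul_le_of_le_one_left this h1⟩

lemma norm_sub_le_of_mem_box (hR : 0 < R) {x y : EuclideanSpace ℝ (Fin d)}
    (hx : x ∈ box d R) (hy : y ∈ box d R) : ‖x - y‖ ≤ R := by
  rcases Nat.eq_zero_or_pos d with rfl | hd
  · rw [Subsingleton.elim (x - y) 0, norm_zero]; exact hR.le
  refine le_of_le_of_eq ?_ (norm_corner (d := d) hd hR)
  rw [EuclideanSpace.norm_eq, EuclideanSpace.norm_eq]
  refine Real.sqrt_le_sqrt (Finset.sum_le_sum fun j _ => ?_)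
  refine pow_le_pow_left₀ (norm_nonneg _) ?_ 2
  have := hx j
  have := hy j
  simp only [PiLp.sub_apply, corner, Real.norm_eq_abs]
  exact (abs_le.2 ⟨by linarith, by linarith⟩).trans (le_abs_self _)

/-- The quadratic loss with curvature `α` and minimizer `a`. -/
noncomputable def quadLoss (α : ℝ) (a x : EuclideanSpace ℝ (Fin d)) : ℝ := α / 2 * ‖x - a‖ ^ 2

lemma hasGradientAt_quadLoss (a x : EuclideanSpace ℝ (Fin d)) :
    HasGradientAt (quadLoss α a) (α • (x - a)) x := by
  rw [hasGradientAt_iff_hasFDerivAt]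
  have h := (((hasFDerivAt_id x).sub_const a).norm_sq).const_mul (α / 2)
  refine h.congr_fderiv ?_
  ext y
  simp
  ring

lemma stronglyConvexLoss_quadLoss (K : Set (EuclideanSpace ℝ (Fin d)))
    (a : EuclideanSpace ℝ (Fin d)) : StronglyConvexLoss K α (quadLoss α a) := by
  refine ⟨fun x _ => (hasGradientAt_quadLoss a x).differentiableAt, fun x _ y _ => le_of_eq ?_⟩
  rw [(hasGradientAt_quadLoss a x).gradient, quadLoss, quadLoss]
  have : y - a = (x - a) + (y - x) := by abel
  rw [this, norm_add_sq_real, real_inner_smul_left]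
  ring

lemma lipschitzLoss_quadLoss (hα : 0 < α) (hR : 0 < R) {a : EuclideanSpace ℝ (Fin d)}
    (ha : a ∈ box d R) : LipschitzLoss (box d R) (α * R) (quadLoss α a) := by
  intro x hx y hy
  have h1 := norm_sub_le_of_mem_box hR hx ha
  have h2 := norm_sub_le_of_mem_box hR hy ha
  have h3 : |‖x - a‖ - ‖y - a‖| ≤ ‖x - y‖ := by
    simpa using abs_norm_sub_norm_le (x - a) (y - a)
  have h4 : quadLoss α a x - quadLoss α a y =
      α / 2 * (‖x - a‖ + ‖y - a‖) * (‖x - a‖ - ‖y - a‖) := by rw [quadLoss, quadLoss]; ring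
  rw [h4, abs_mul, abs_of_nonneg (by positivity)]
  refine mul_le_mul ?_ h3 (abs_nonneg _) (by positivity)
  nlinarith

/-- The distance to a point of the diagonal is at least that of the projection onto the diagonal. -/
lemma le_norm_sub_smul_corner_sq (hd : 1 ≤ d) (hR : 0 < R) (x : EuclideanSpace ℝ (Fin d)) (c : ℝ) :
    R ^ 2 * (inner ℝ x (corner d R) / R ^ 2 - c) ^ 2 ≤ ‖x - c • corner d R‖ ^ 2 := by
  have h1 := real_inner_mul_inner_self_le (x - c • corner d R) (corner d R)
  rw [real_inner_self_eq_norm_sq, real_inner_self_eq_norm_sq, norm_corner hd hR, inner_sub_left,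
    real_inner_smul_left, real_inner_self_eq_norm_sq, norm_corner hd hR] at h1
  have hR2 : 0 < R ^ 2 := by positivity
  refine le_of_mul_le_mul_right ?_ hR2
  refine le_trans (le_of_eq ?_) h1
  field_simp

lemma norm_smul_corner_sub_sq (hd : 1 ≤ d) (hR : 0 < R) (b c : ℝ) :
    ‖b • corner d R - c • corner d R‖ ^ 2 = R ^ 2 * (b - c) ^ 2 := by
  rw [← sub_smul, norm_smul, norm_corner hd hR, mul_pow, Real.norm_eq_abs, sq_abs]; ring

end Quadratic

/-! ### The hard instance and its regret -/

section HardInstance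

/-- The learners at cyclic distance at least `D` from learner `0`. -/
def farLearners (n D : ℕ) : Finset (Fin n) := {j | D ≤ min j.val (n - j.val)}

/-- Minimizers of the hard losses along the diagonal: in block `k` of length `D` the far learners
have `w k` and the others `0`; after `B` blocks everybody has the minimizer of the past. -/
noncomputable def hardCenter (n D B : ℕ) (w : ℕ → Bool) (t : ℕ) (j : Fin n) : ℝ :=
  if t < B * D then (if j ∈ farLearners n D then bit (w (t / D)) else 0)
  else (farLearners n D).card / n * (successes B w / B)

noncomputable def hardLoss (n d D B : ℕ) (α R : ℝ) (w : ℕ → Bool) (t : ℕ) (j : Fin n) :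
    EuclideanSpace ℝ (Fin d) → ℝ :=
  quadLoss α (hardCenter n D B w t j • corner d R)

variable {n d D B : ℕ} {α R : ℝ}

/-- This number places the comparator on the diagonal; the bounds keep it in the box. -/
lemma farLearners_ratio_mem (n D B : ℕ) (w : ℕ → Bool) :
    0 ≤ ((farLearners n D).card / n * (successes B w / B) : ℝ) ∧
      ((farLearners n D).card / n * (successes B w / B) : ℝ) ≤ 1 := by
  have h0 := successes_nonneg B w
  have hc : ((farLearners n D).card : ℝ) ≤ n := by
    exact_mod_cast (Finset.card_le_univ (farLearners n D)).trans (by simp)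
  refine ⟨by positivity, ?_⟩
  exact mul_le_one₀ (div_le_one_of_le₀ hc (by positivity)) (by positivity)
    (div_le_one_of_le₀ (successes_le B w) (by positivity))

lemma hardCenter_mem (w : ℕ → Bool) (t : ℕ) (j : Fin n) :
    0 ≤ hardCenter n D B w t j ∧ hardCenter n D B w t j ≤ 1 := by
  unfold hardCenter
  split_ifs
  · exact ⟨bit_nonneg _, bit_le_one _⟩
  · simp
  · exact farLearners_ratio_mem n D B w

lemma admissibleLosses_hardLoss (hα : 0 < α) (hR : 0 < R) (T : ℕ) (w : ℕ → Bool) :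
    AdmissibleLosses (box d R) α (α * R) T (hardLoss n d D B α R w) := fun t _ j =>
  ⟨stronglyConvexLoss_quadLoss _ _, lipschitzLoss_quadLoss hα hR
    (smul_corner_mem_box hR (hardCenter_mem w t j).1 (hardCenter_mem w t j).2)⟩

lemma globalLoss_hardLoss_nonneg (hα : 0 < α) (w : ℕ → Bool) (t : ℕ)
    (x : EuclideanSpace ℝ (Fin d)) : 0 ≤ globalLoss (hardLoss n d D B α R w) t x :=
  Finset.sum_nonneg fun j _ => by unfold hardLoss quadLoss; positivity

/-- After projection to the diagonal, the sum over learners is a quadratic in one variable,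
minimized at `F / n` times the bit, where `F` is the number of far learners. Rescaling by `n / F`
leaves a square-loss difference with factor `F² / n`. -/
lemma le_globalLoss_sub (hd : 1 ≤ d) (hα : 0 < α) (hR : 0 < R) (hF : (farLearners n D).Nonempty)
    (w : ℕ → Bool) {t : ℕ} (ht : t < B * D) (x : EuclideanSpace ℝ (Fin d)) (m : ℝ) :
    α * R ^ 2 * (farLearners n D).card ^ 2 / (2 * n) *
        ((n / (farLearners n D).card * (inner ℝ x (corner d R) / R ^ 2) - bit (w (t / D))) ^ 2 -
          (m - bit (w (t / D))) ^ 2) ≤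
      globalLoss (hardLoss n d D B α R w) t x -
        globalLoss (hardLoss n d D B α R w) t
          (((farLearners n D).card / n * m : ℝ) • corner d R) := by
  set F := (farLearners n D).card with hFdef
  have hF0 : (0 : ℝ) < F := by exact_mod_cast hF.card_pos
  have hn : (0 : ℝ) < n := lt_of_lt_of_le hF0 <| by
    exact_mod_cast (Finset.card_le_univ (farLearners n D)).trans (by simp)
  set z := inner ℝ x (corner d R) / R ^ 2 with hz
  set y := bit (w (t / D))
  have hc : ∀ j, hardCenter n D B w t j = if j ∈ farLearners n D then y else 0 := fun j => by
    rw [hardCenter, if_pos ht]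
  have hsumc : ∑ j, hardCenter n D B w t j = F * y := by
    simp only [hc, Finset.sum_ite_mem, Finset.univ_inter, Finset.sum_const, nsmul_eq_mul, hFdef]
  set q : ℝ := F / n * m
  have hterm : ∀ j, α / 2 * R ^ 2 * ((z ^ 2 - q ^ 2) - 2 * (z - q) * hardCenter n D B w t j) ≤
      hardLoss n d D B α R w t j x - hardLoss n d D B α R w t j (q • corner d R) := by
    intro j
    rw [hardLoss, quadLoss, quadLoss, norm_smul_corner_sub_sq hd hR, ← mul_sub]
    have := le_norm_sub_smul_corner_sq hd hR x (hardCenter n D B w t j)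
    rw [← hz] at this
    rw [mul_assoc]
    refine mul_le_mul_of_nonneg_left ?_ (by positivity)
    nlinarith
  rw [globalLoss, globalLoss, ← Finset.sum_sub_distrib]
  refine le_trans (le_of_eq ?_) (Finset.sum_le_sum fun j _ => hterm j)
  rw [← Finset.mul_sum, Finset.sum_sub_distrib, ← Finset.mul_sum, hsumc]
  simp only [Finset.sum_const, Finset.card_univ, Fintype.card_fin, nsmul_eq_mul, q]
  field_simp
  ring

lemma sum_range_mul_eq (B D : ℕ) (g : ℕ → ℝ) :
    ∑ t ∈ Finset.range (B * D), g t =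
      ∑ r ∈ Finset.range D, ∑ k ∈ Finset.range B, g (k * D + r) := by
  induction B with
  | zero => simp
  | succ B ih =>
    rw [Nat.succ_mul, Finset.sum_range_add, ih, ← Finset.sum_add_distrib]
    exact Finset.sum_congr rfl fun r _ => by rw [Finset.sum_range_succ]

/-- The rescaled position of the decision along the diagonal. -/
noncomputable def prediction {G : SimpleGraph (Fin n)} (A : Algorithm.{u, v} G (box d R))
    (α : ℝ) (D B t : ℕ) (i : Fin n) (w : ℕ → Bool) : ℝ :=
  n / (farLearners n D).card *
    (inner ℝ (A.decision (hardLoss n d D B α R w) t i) (corner d R) / R ^ 2)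

lemma sum_le_regret {G : SimpleGraph (Fin n)} (A : Algorithm.{u, v} G (box d R)) {T : ℕ}
    (hd : 1 ≤ d) (hα : 0 < α) (hR : 0 < R) (hF : (farLearners n D).Nonempty) (hD : 1 ≤ D)
    (hT : B * D ≤ T) (i : Fin n) (w : ℕ → Bool) :
    α * R ^ 2 * (farLearners n D).card ^ 2 / (2 * n) *
        ∑ r ∈ Finset.range D, ∑ k ∈ Finset.range B,
          ((prediction A α D B (k * D + r) i w - bit (w k)) ^ 2 -
            (successes B w / B - bit (w k)) ^ 2) ≤
      regret A (hardLoss n d D B α R w) T i := by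
  set f := hardLoss n d D B α R w with hf
  set y : EuclideanSpace ℝ (Fin d) :=
    ((farLearners n D).card / n * (successes B w / B) : ℝ) • corner d R with hy
  have hymem : y ∈ box d R :=
    smul_corner_mem_box hR (farLearners_ratio_mem n D B w).1 (farLearners_ratio_mem n D B w).2
  have hinf : sInf ((fun x => ∑ t ∈ Finset.range T, globalLoss f t x) '' box d R) ≤
      ∑ t ∈ Finset.range T, globalLoss f t y := by
    refine csInf_le ⟨0, ?_⟩ ⟨y, hymem, rfl⟩
    rintro _ ⟨x, _, rfl⟩
    exact Finset.sum_nonneg fun t _ => globalLoss_hardLoss_nonneg hα w t x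
  have hreg : ∑ t ∈ Finset.range T, (globalLoss f t (A.decision f t i) - globalLoss f t y) ≤
      regret A f T i := by
    rw [Finset.sum_sub_distrib, regret]; linarith
  refine le_trans ?_ hreg
  have hsub : ∑ t ∈ Finset.range (B * D),
        (globalLoss f t (A.decision f t i) - globalLoss f t y) ≤
      ∑ t ∈ Finset.range T, (globalLoss f t (A.decision f t i) - globalLoss f t y) := by
    -- Rounds after the last block are harmless: every loss is centred at the comparator, which pays
    -- `0` there.
    refine Finset.sum_le_sum_of_subset_of_nonneg (by simpa using hT) fun t _ ht => ?_
    have ht : ¬ t < B * D := by simpa using ht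
    have : globalLoss f t y = 0 := by
      refine Finset.sum_eq_zero fun j _ => ?_
      simp [hf, hardLoss, quadLoss, hardCenter, ht, hy]
    rw [this, sub_zero]
    exact globalLoss_hardLoss_nonneg hα w t _
  refine le_trans ?_ hsub
  rw [sum_range_mul_eq, Finset.mul_sum]
  refine Finset.sum_le_sum fun r hr => ?_
  rw [Finset.mul_sum]
  refine Finset.sum_le_sum fun k hk => ?_
  have hr := Finset.mem_range.1 hr
  have hk := Finset.mem_range.1 hk
  have hlt : k * D + r < B * D := by nlinarith
  have hdiv : (k * D + r) / D = k := by
    rw [Nat.mul_comm, Nat.mul_add_div (by omega), Nat.div_eq_of_lt hr, add_zero]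
  have := le_globalLoss_sub hd hα hR hF w hlt (A.decision f (k * D + r) i) (successes B w / B)
  rwa [hdiv] at this

/-- Within block `k`, learner `0` has not seen the losses of the far learners in block `k`. -/
lemma prediction_congr (A : Algorithm.{u, v} (SimpleGraph.cycleGraph n) (box d R))
    {i : Fin n} (hi : i.val = 0) {k r : ℕ} (hr : r < D) (hk : k < B) {w w' : ℕ → Bool}
    (hw : ∀ j < k, w j = w' j) :
    prediction A α D B (k * D + r) i w = prediction A α D B (k * D + r) i w' := by
  have hle : k * D + r ≤ B * D := by nlinarith
  have : A.stateAt (hardLoss n d D B α R w) (k * D + r) i =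
      A.stateAt (hardLoss n d D B α R w') (k * D + r) i := by
    -- Exactly the far learners have height `0`, and learner `0` has height `D`. The cutoff `b = B *
    -- D` matters because later losses depend on all of `w`.
    refine A.stateAt_congr (fun j => D - min j.val (n - j.val)) (fun i j hij => ?_)
      (a := k * D) (b := B * D) (fun s j hs hsj => ?_) _ _ hle ?_
    · have := cycleGraph_adj_min_le hij
      omega
    · rw [hardLoss, hardLoss, hardCenter, hardCenter, if_pos hs, if_pos hs]
      rcases hsj with h | h
      · rw [hw _ ((Nat.div_lt_iff_lt_mul (by omega)).2 h)]
      · have : j ∉ farLearners n D := by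
          rw [farLearners, Finset.mem_filter_univ]; omega
        rw [if_neg this, if_neg this]
    · simp only [hi]; omega
  rw [prediction, prediction, Algorithm.decision, Algorithm.decision, this]

/-- The `D` offsets give `D` prediction games on the same bits; linearity of the urn expectation
adds their lower bounds. -/
lemma log_le_urn_regret_hardLoss (A : Algorithm.{u, v} (SimpleGraph.cycleGraph n) (box d R))
    {T : ℕ} (hd : 1 ≤ d) (hα : 0 < α) (hR : 0 < R) (hF : (farLearners n D).Nonempty) (hD : 1 ≤ D)
    (hB : 1 ≤ B) (hT : B * D ≤ T) {i : Fin n} (hi : i.val = 0) :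
    α * R ^ 2 * (farLearners n D).card ^ 2 / (2 * n) * (D * (Real.log ((B : ℝ) + 2) / 6)) ≤
      urn B (fun w => regret A (hardLoss n d D B α R w) T i) := by
  refine le_trans ?_ (urn_mono B fun w => sum_le_regret A hd hα hR hF hD hT i w)
  rw [urn_const_mul, urn_sum]
  refine mul_le_mul_of_nonneg_left ?_ (by positivity)
  have : ∀ r ∈ Finset.range D, Real.log ((B : ℝ) + 2) / 6 ≤
      urn B (fun w => ∑ k ∈ Finset.range B,
        ((prediction A α D B (k * D + r) i w - bit (w k)) ^ 2 -
          (successes B w / B - bit (w k)) ^ 2)) := by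
    intro r hr
    have hr := Finset.mem_range.1 hr
    have h := log_le_urn_regret
      -- The value `0` beyond block `B` keeps the predictor causal for every `k`, as
      -- `log_le_urn_regret` demands.
      (fun k w => if k < B then prediction A α D B (k * D + r) i w else 0)
      (fun k w w' hw => by
        split_ifs with hk
        · exact prediction_congr A hi hr hk hw
        · rfl) hB
    refine h.trans (le_of_eq ?_)
    congr 1; funext w
    exact Finset.sum_congr rfl fun k hk => by rw [if_pos (Finset.mem_range.1 hk)]
  calc (D : ℝ) * (Real.log ((B : ℝ) + 2) / 6)
      = ∑ r ∈ Finset.range D, Real.log ((B : ℝ) + 2) / 6 := by simp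
    _ ≤ _ := Finset.sum_le_sum this

lemma integrable_regret_hardLoss {Ω : Type*} [MeasurableSpace Ω] {μ : Measure Ω}
    [IsFiniteMeasure μ] {G : SimpleGraph (Fin n)} (A : Ω → Algorithm.{u, v} G (box d R)) {T : ℕ}
    (hR : 0 < R) (i : Fin n) (w : ℕ → Bool)
    (hA : ∀ t < T, AEStronglyMeasurable
      (fun ω => (A ω).decision (hardLoss n d D B α R w) t i) μ) :
    Integrable (fun ω => regret (A ω) (hardLoss n d D B α R w) T i) μ := by
  unfold regret
  refine Integrable.sub ?_ (integrable_const _)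
  refine integrable_finsetSum _ fun t ht => ?_
  unfold globalLoss
  refine integrable_finsetSum _ fun j _ => ?_
  unfold hardLoss quadLoss
  set a := hardCenter n D B w t j • corner d R with ha
  have hmem : a ∈ box d R :=
    smul_corner_mem_box hR (hardCenter_mem w t j).1 (hardCenter_mem w t j).2
  refine Integrable.const_mul ?_ _
  refine Integrable.of_bound
    (((hA t (Finset.mem_range.1 ht)).sub aestronglyMeasurable_const).norm.pow 2) (R ^ 2)
    (Filter.Eventually.of_forall fun ω => ?_)
  rw [norm_pow, norm_norm]
  exact pow_le_pow_left₀ (norm_nonneg _)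
    (norm_sub_le_of_mem_box hR ((A ω).decide_mem t i _) hmem) 2

/-- For every randomized algorithm there are hard losses that do not depend on the seed. -/
lemma exists_le_integral_regret {Ω : Type*} [MeasurableSpace Ω] {μ : Measure Ω}
    [IsProbabilityMeasure μ]
    (A : Ω → Algorithm.{u, v} (SimpleGraph.cycleGraph n) (box d R))
    {T : ℕ} (hd : 1 ≤ d) (hα : 0 < α) (hR : 0 < R) (hF : (farLearners n D).Nonempty) (hD : 1 ≤ D)
    (hB : 1 ≤ B) (hT : B * D ≤ T) {i : Fin n} (hi : i.val = 0)
    (hA : ∀ w, ∀ t < T, AEStronglyMeasurable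
      (fun ω => (A ω).decision (hardLoss n d D B α R w) t i) μ) :
    ∃ w, α * R ^ 2 * (farLearners n D).card ^ 2 / (2 * n) * (D * (Real.log ((B : ℝ) + 2) / 6)) ≤
      ∫ ω, regret (A ω) (hardLoss n d D B α R w) T i ∂μ := by
  refine exists_le_of_le_urn (k := B) ?_
  obtain ⟨h1, h2⟩ := urn_integral μ B (fun ω w => regret (A ω) (hardLoss n d D B α R w) T i)
    (fun w => integrable_regret_hardLoss A hR i w (hA w))
  rw [h2]
  calc _ = ∫ _ω, α * R ^ 2 * (farLearners n D).card ^ 2 / (2 * n) *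
        (D * (Real.log ((B : ℝ) + 2) / 6)) ∂μ := by simp
    _ ≤ _ := integral_mono (integrable_const _) h1 fun ω =>
      log_le_urn_regret_hardLoss (A ω) hd hα hR hF hD hB hT hi

end HardInstance

/-! ### Constants and the final bounds -/

lemma le_two_mul_card_farLearners {n D : ℕ} (hD : 1 ≤ D) (hn : 4 * D ≤ n) :
    n ≤ 2 * (farLearners n D).card := by
  -- The far indices `D, …, n - D` number `n - 2 D + 1`, more than `n / 2`.
  have hsub : Finset.Icc D (n - D) ⊆ (farLearners n D).map Fin.valEmbedding := by
    intro j hj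
    rw [Finset.mem_Icc] at hj
    rw [Finset.mem_map]
    exact ⟨⟨j, by omega⟩, by rw [farLearners, Finset.mem_filter_univ]; simp only; omega, rfl⟩
  have := Finset.card_le_card hsub
  rw [Finset.card_map, Nat.card_Icc] at this
  omega

/-- With blocks of length `n / 4`, the hard instance forces regret of order `n ^ 2 log (T / n)`. -/
lemma log_le_hardness {n T F D B : ℕ} {α R : ℝ} (hα : 0 < α) (hn : 4 ≤ n) (hT : 16 * n + 1 ≤ T)
    (hD : 1 ≤ D) (hDn : 4 * D ≤ n) (hnD : n ≤ 4 * D + 2) (hF : n ≤ 2 * F) (hB : B = T / D) :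
    α * R ^ 2 * n * (n - 2) / 192 * Real.log (4 * T / n) ≤
      α * R ^ 2 * F ^ 2 / (2 * n) * (D * (Real.log ((B : ℝ) + 2) / 6)) := by
  have hn' : (4 : ℝ) ≤ n := by exact_mod_cast hn
  have hT' : 16 * (n : ℝ) + 1 ≤ T := by exact_mod_cast hT
  have hF' : (n : ℝ) ≤ 2 * F := by exact_mod_cast hF
  have hDn' : 4 * (D : ℝ) ≤ n := by exact_mod_cast hDn
  have hnD' : (n : ℝ) ≤ 4 * D + 2 := by exact_mod_cast hnD
  have hD' : (0 : ℝ) < D := by exact_mod_cast hD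
  have hn0 : (0 : ℝ) < n := by linarith
  have hTB : (T : ℝ) ≤ (B + 1) * D := by
    have : T < (B + 1) * D := by
      rw [hB, mul_comm]; exact Nat.lt_mul_div_succ T (by omega)
    exact_mod_cast this.le
  have hx1 : 1 ≤ 4 * (T : ℝ) / n := by rw [le_div_iff₀ hn0]; linarith
  have hx : 4 * (T : ℝ) / n ≤ B + 2 := by
    rw [div_le_iff₀ hn0]
    have : (0 : ℝ) ≤ B := by positivity
    nlinarith
  have hlog : Real.log (4 * T / n) ≤ Real.log ((B : ℝ) + 2) :=
    Real.log_le_log (by linarith) hx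
  have hlog0 : 0 ≤ Real.log (4 * T / n) := Real.log_nonneg hx1
  -- Here `F ≥ n / 2` and `D ≥ (n - 2) / 4`; with the `6` from the urn bound they make `192 = 8 * 4
  -- * 6`.
  have hFn : (n : ℝ) / 8 ≤ F ^ 2 / (2 * n) := by
    rw [le_div_iff₀ (by positivity)]; nlinarith
  have hc : (n : ℝ) * (n - 2) / 32 ≤ F ^ 2 / (2 * n) * D := by
    calc (n : ℝ) * (n - 2) / 32 = n / 8 * ((n - 2) / 4) := by ring
      _ ≤ _ := mul_le_mul hFn (by linarith) (by linarith) (by positivity)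
  calc α * R ^ 2 * n * (n - 2) / 192 * Real.log (4 * T / n)
      = α * R ^ 2 / 6 * ((n * (n - 2) / 32) * Real.log (4 * T / n)) := by ring
    _ ≤ α * R ^ 2 / 6 * ((F ^ 2 / (2 * n) * D) * Real.log ((B : ℝ) + 2)) := by
        refine mul_le_mul_of_nonneg_left ?_ (by positivity)
        exact mul_le_mul hc hlog hlog0 (by positivity)
    _ = _ := by ring

/-- As `30 (T - 1) / N ≤ 8 * (4 T / N)` and `4 T / N ≥ 8`, the logarithm on the left is at most `2
L`, and `log 16 ≥ 2` absorbs the factor. The numerical constants leave ample room. -/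
lemma explicit_bound_le {α R N T r : ℝ} (hα : 0 < α) (hN : 4 ≤ N) (hT : 16 * N + 1 ≤ T)
    (hr : 1 / r ≤ 4 * N) (hr0 : 0 ≤ r) :
    (16 : ℝ) ^ (-5 : ℤ) * α * Real.pi * (Real.logb 16 (30 * (T - 1) / N) - 2) * (N - 2) * R ^ 2 /
      (4 * r) ≤ α * R ^ 2 * N * (N - 2) / 192 * Real.log (4 * T / N) := by
  set L := Real.log (4 * T / N)
  have hN0 : 0 < N := by linarith
  have hL : Real.logb 16 (30 * (T - 1) / N) - 2 ≤ L := by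
    have h8 : Real.log 8 ≤ L := by
      refine Real.log_le_log (by norm_num) ?_
      rw [le_div_iff₀ hN0]; linarith
    have hx : Real.log (30 * (T - 1) / N) ≤ Real.log 8 + L := by
      have h4 : 0 < 4 * T / N := div_pos (by linarith) hN0
      rw [← Real.log_mul (by norm_num) h4.ne', ← mul_div_assoc]
      exact Real.log_le_log (div_pos (by linarith) hN0)
        (div_le_div_of_nonneg_right (by linarith) hN0.le)
    have h16 : 2 ≤ Real.log 16 := by
      rw [show (16 : ℝ) = 2 ^ 4 by norm_num, Real.log_pow]
      have := Real.log_two_gt_d9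
      norm_num; linarith
    have hL0 : 0 ≤ L := (Real.log_nonneg (by norm_num)).trans h8
    have : Real.logb 16 (30 * (T - 1) / N) ≤ L := by
      rw [Real.logb, div_le_iff₀ (by linarith)]
      nlinarith
    linarith
  have hL0 : 0 ≤ L := Real.log_nonneg (by rw [le_div_iff₀ hN0]; linarith)
  have hpi := Real.pi_lt_four
  have h0 : 0 ≤ (16 : ℝ) ^ (-5 : ℤ) * α * Real.pi * (N - 2) * R ^ 2 / 4 :=
    div_nonneg (mul_nonneg (mul_nonneg (by positivity) (by linarith)) (sq_nonneg _)) (by norm_num)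
  have h1 : 0 ≤ α * R ^ 2 * N * (N - 2) * L :=
    mul_nonneg (mul_nonneg (by positivity) (by linarith)) hL0
  calc _ = (16 : ℝ) ^ (-5 : ℤ) * α * Real.pi * (N - 2) * R ^ 2 / 4 *
        ((Real.logb 16 (30 * (T - 1) / N) - 2) * (1 / r)) := by ring
    _ ≤ (16 : ℝ) ^ (-5 : ℤ) * α * Real.pi * (N - 2) * R ^ 2 / 4 * (L * (4 * N)) := by
        refine mul_le_mul_of_nonneg_left ?_ h0
        calc _ ≤ L * (1 / r) := mul_le_mul_of_nonneg_right hL (by positivity)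
          _ ≤ _ := mul_le_mul_of_nonneg_left hr hL0
    _ = ((16 : ℝ) ^ (-5 : ℤ) * Real.pi) * (α * R ^ 2 * N * (N - 2) * L) := by ring
    _ ≤ (1 / 192) * (α * R ^ 2 * N * (N - 2) * L) := by
        refine mul_le_mul_of_nonneg_right ?_ h1
        norm_num; linarith
    _ = _ := by ring

/-- Polynomial growth of `T` makes `log (T / N)` at least the fraction `δ / (1 + δ)` of `log T`. In
`1536 = 192 * 4 * 2`, the `4` comes from `hr` and the `2` from `N - 2 ≥ N / 2`. -/
lemma asymptotic_bound_le {α R N T r δ : ℝ} (hδ : 0 < δ) (hα : 0 < α) (hN : 4 ≤ N)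
    (hT : 16 * N + 1 ≤ T) (hr : 1 / r ≤ 4 * N) (hNT : N ^ (1 + δ) ≤ T) :
    δ / (1 + δ) / 1536 * α * R ^ 2 * N * Real.log T / r ≤
      α * R ^ 2 * N * (N - 2) / 192 * Real.log (4 * T / N) := by
  have hN0 : 0 < N := by linarith
  have hT0 : 0 < T := by linarith
  have hlT : 0 ≤ Real.log T := Real.log_nonneg (by linarith)
  have hlN : Real.log N ≤ Real.log T / (1 + δ) := by
    rw [le_div_iff₀ (by linarith), mul_comm, ← Real.log_rpow hN0]
    exact Real.log_le_log (by positivity) hNT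
  have hL : δ / (1 + δ) * Real.log T ≤ Real.log (4 * T / N) := by
    rw [Real.log_div (by positivity) hN0.ne', Real.log_mul (by norm_num) hT0.ne']
    have : Real.log T - Real.log T / (1 + δ) = δ / (1 + δ) * Real.log T := by field_simp; ring
    have := Real.log_nonneg (show (1 : ℝ) ≤ 4 by norm_num)
    linarith
  have h0 : 0 ≤ δ / (1 + δ) * Real.log T := by positivity
  calc _ = α * R ^ 2 * N / 1536 * ((δ / (1 + δ) * Real.log T) * (1 / r)) := by ring
    _ ≤ α * R ^ 2 * N / 1536 * ((δ / (1 + δ) * Real.log T) * (4 * N)) := by gcongr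
    _ = α * R ^ 2 * N / 192 * ((N / 2) * (δ / (1 + δ) * Real.log T)) := by ring
    _ ≤ α * R ^ 2 * N / 192 * ((N - 2) * Real.log (4 * T / N)) := by
        refine mul_le_mul_of_nonneg_left ?_ (by positivity)
        exact mul_le_mul (by linarith) hL h0 (by linarith)
    _ = _ := by ring

end DOCO

/-- Lower bound for decentralized online optimization with strongly convex losses. The algorithm
`A` may depend on `T`, `α`, `R`, on the graph and on the communication matrix, and it may be
randomized: `A ω` is the deterministic algorithm run on the random seed `ω` (for a deterministic
algorithm take `Ω` to be a point). The losses, the graph and the matrix do not depend on `ω`. -/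
theorem theorem4 (δ : ℝ) (hδ : 0 < δ) :
    ∃ c : ℝ, 0 < c ∧
      ∀ (n m d T : ℕ) (hm : 1 ≤ m) (hn : n = 2 * (m + 1)) (_hd : 1 ≤ d) (_hT : 16 * n + 1 ≤ T)
        (α R : ℝ) (_hα : 0 < α) (_hR : 0 < R)
        (Ω : Type*) [MeasurableSpace Ω] (μ : Measure Ω) [IsProbabilityMeasure μ]
        (A : Ω → (G : SimpleGraph (Fin n)) → Matrix (Fin n) (Fin n) ℝ →
          DOCO.Algorithm G (DOCO.box d R))
        (_hA : ∀ G P, DOCO.IsCommunicationMatrix G P →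
          ∀ f, DOCO.AdmissibleLosses (DOCO.box d R) α (α * R) T f →
            ∀ t < T, ∀ i, AEStronglyMeasurable (fun ω => (A ω G P).decision f t i) μ),
        ∃ (f : ℕ → Fin n → EuclideanSpace ℝ (Fin d) → ℝ) (G : SimpleGraph (Fin n))
          (P : Matrix (Fin n) (Fin n) ℝ),
          DOCO.AdmissibleLosses (DOCO.box d R) α (α * R) T f ∧
          G = SimpleGraph.cycleGraph n ∧
          DOCO.IsCommunicationMatrix G P ∧
          (16 : ℝ) ^ (-5 : ℤ) * α * Real.pi *
              (Real.logb 16 (30 * ((T : ℝ) - 1) / n) - 2) * ((n : ℝ) - 2) * R ^ 2 /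
              (4 * √(1 - DOCO.sigma2 P))
            ≤ ∫ ω, DOCO.regret (A ω G P) f T ⟨0, by omega⟩ ∂μ ∧
          ((n : ℝ) ^ (1 + δ) ≤ T →
            c * α * R ^ 2 * n * Real.log T / √(1 - DOCO.sigma2 P)
              ≤ ∫ ω, DOCO.regret (A ω G P) f T ⟨0, by omega⟩ ∂μ) := by
  refine ⟨δ / (1 + δ) / 1536, by positivity, ?_⟩
  intro n m d T hm hn hd hT α R hα hR Ω _ μ _ A hA
  have hn4 : 4 ≤ n := by omega
  have : NeZero n := ⟨by omega⟩
  have hP := DOCO.isCommunicationMatrix_lazyWalk (n := n) (by omega)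
  set D := n / 4 with hD
  have hD1 : 1 ≤ D := by omega
  have hF := DOCO.le_two_mul_card_farLearners hD1 (show 4 * D ≤ n by omega)
  have hadm := fun w => DOCO.admissibleLosses_hardLoss (n := n) (d := d) (D := D) (B := T / D)
    hα hR T w
  obtain ⟨w, hw⟩ := DOCO.exists_le_integral_regret (μ := μ) (D := D) (B := T / D)
    (fun ω => A ω (SimpleGraph.cycleGraph n) (DOCO.lazyWalk n)) hd hα hR
    (Finset.card_pos.1 (by omega)) hD1 ((Nat.one_le_div_iff (by omega)).2 (by omega))
    (Nat.div_mul_le_self T D) (i := ⟨0, by omega⟩) rfl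
    (fun w t ht => hA _ _ hP _ (hadm w) t ht _)
  -- Since `n` is even, its remainder modulo `4` is at most `2`, hence `n ≤ 4 * D + 2`.
  have hw' := (DOCO.log_le_hardness (R := R) hα hn4 hT hD1 (by omega) (by omega) hF rfl).trans hw
  have hr := DOCO.one_div_sqrt_one_sub_sigma2_lazyWalk_le (n := n)
  have hn4' : (4 : ℝ) ≤ n := by exact_mod_cast hn4
  have hT' : 16 * (n : ℝ) + 1 ≤ T := by exact_mod_cast hT
  refine ⟨DOCO.hardLoss n d D (T / D) α R w, _, DOCO.lazyWalk n, hadm w, rfl, hP, ?_, fun hnT => ?_⟩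
  · exact (DOCO.explicit_bound_le hα hn4' hT' hr (Real.sqrt_nonneg _)).trans hw'
  · exact (DOCO.asymptotic_bound_le hδ hα hn4' hT' hr hnT).trans hw'
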